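/- Let $0<p<1$. For every block length $n$ let $\mathbb F_{(n)}$ be a finite field, with $m_n$ elements, such that $p>(1-p)/(m_n-1)$. A word $c\in\mathbb F_{(n)}^n$ is sent over $n$ independent uses of the $m_n$-ary symmetric channel, $\Pr(r\mid c)=p$ if $r=c$ and $(1-p)/(m_n-1)$ if $r\ne c$. The error pattern $x^n\in\{0,1\}^n$ has $x_i=1$ if and only if $r_i=c_i$ (so it is i.i.d. with $\Pr(x_i=1)=p$). Multiple errors-and-erasures decoding mBM-1 with a set $\mathcal B\subseteq\{0,1\}^n$ of erasure patterns makes $|\mathcal B|$ decoding attempts; let $d(x^n,\hat x^n)=\sum_i\delta(x_i,\hat x_i)$ with $\delta(0,0)=1$, $\delta(0,1)=2$, $\delta(1,0)=1$, $\delta(1,1)=0$, and, for a threshold $\Delta$, let $p_e(\mathcal B,\Delta)=\Pr\bigl(\min_{\hat x^n\in\mathcal B}d(x^n,\hat x^n)>\Delta\bigr)$. Let $N\ge1$ be an integer and let $R$, $D$ be real with $0<D<N$. An (unnormalized) exponent $F$ is achievable with $2^R$ decoding attempts at distortion $D$ if there are sets $\mathcal B_n\subseteq\{0,1\}^n$ with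 $|\mathcal B_n|\le 2^{nR/N}$ for all $n$ such that for every $\epsilon>0$ and all sufficiently large $n$, $p_e(\mathcal B_n,nD/N)\le 2^{-n(F/N-\epsilon)}$. Let $H(u)=-u\log_2u-(1-u)\log_2(1-u)$, $D_{KL}(u\|p)=u\log_2\frac up+(1-u)\log_2\frac{1-u}{1-p}$ and $h(u)=H(u)-H(u+\frac DN-1)$. Assume $R\in(0,\,N\,H(1-\frac DN)]$. Then $h$ is a bijection from $[1-\frac DN,\,1-\frac D{2N})$ onto $(0,H(1-\frac DN)]$; let $h^{-1}$ be its inverse. If $h^{-1}(R/N)\le p$, then the maximum achievable exponent is $$F=N\,D_{KL}\bigl(h^{-1}(R/N)\,\big\|\,p\bigr),$$ that is, $F$ is achievable and no larger exponent is; moreover, for all sets $\mathcal B_n\subseteq\{0,1\}^n$ with $|\mathcal B_n|\le2^{nR/N}$ and every $\epsilon>0$, $p_e(\mathcal B_n,nD/N)\ge2^{-n(F/N+\epsilon)}$ for all sufficiently large $n$. -/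

import Mathlib

open Filter

noncomputable section

/-- Binary entropy in bits. -/
def H₂ (u : ℝ) : ℝ := Real.binEntropy u / Real.log 2

/-- Binary Kullback-Leibler divergence in bits (used for `0 < u < 1` and `0 < p < 1` only). -/
def klBits (u p : ℝ) : ℝ :=
  u * Real.logb 2 (u / p) + (1 - u) * Real.logb 2 ((1 - u) / (1 - p))

/-- `h(u) = H(u) - H(u + d - 1)`, where `d` is the distortion per letter. -/
def hRate (d u : ℝ) : ℝ := H₂ u - H₂ (u + d - 1)

/-- The interval `[1 - d, 1 - d/2)` on which `h` is inverted. -/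
def hDomain (d : ℝ) : Set ℝ := Set.Ico (1 - d) (1 - d / 2)

/-- The inverse of `h : [1 - d, 1 - d/2) → (0, H(1 - d)]`. -/
def hInv (d r : ℝ) : ℝ := Function.invFunOn (hRate d) (hDomain d) r

/-- The letter distortion of mBM-1; row: error-pattern letter (`1` = hard decision correct),
column: erasure-pattern letter (`0` = erase, `1` = keep the hard decision). -/
def δmBM1 : Matrix (Fin 2) (Fin 2) ℝ := !![1, 2; 1, 0]

/-- Total distortion between an error pattern and an erasure pattern. -/
def distortion {n : ℕ} (x y : Fin n → Fin 2) : ℝ := ∑ i, δmBM1 (x i) (y i)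

/-- Transition probability `Pr(r | c)` of the `m`-ary symmetric channel, `m = |𝔽|`. -/
def mSC (𝔽 : Type*) [Fintype 𝔽] [DecidableEq 𝔽] (p : ℝ) (c r : 𝔽) : ℝ :=
  if r = c then p else (1 - p) / ((Fintype.card 𝔽 : ℝ) - 1)

/-- Error pattern: the hard decision at each index is the received symbol, and the letter is `1`
exactly if it is correct. -/
def errorPattern {𝔽 : Type*} [DecidableEq 𝔽] {n : ℕ} (c r : Fin n → 𝔽) : Fin n → Fin 2 :=
  fun i => if r i = c i then 1 else 0

open Classical in
/-- `p_e = Pr(min_{y ∈ B} d(x, y) > D)`, where `x` is the random error pattern when the word `c` is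
sent over `n` independent uses of the `m`-ary symmetric channel. -/
def errorProb {𝔽 : Type*} [Fintype 𝔽] [DecidableEq 𝔽] {n : ℕ} (p D : ℝ)
    (B : Finset (Fin n → Fin 2)) (c : Fin n → 𝔽) : ℝ :=
  ∑ r : Fin n → 𝔽,
    if ∀ y ∈ B, D < distortion (errorPattern c r) y then ∏ i, mSC 𝔽 p (c i) (r i) else 0

/-- A choice, for every block length `n`, of a set of erasure patterns with at most `2 ^ (n ρ)`
elements, i.e. at most that many decoding attempts. -/
def HasRate (ρ : ℝ) (B : ∀ n : ℕ, Finset (Fin n → Fin 2)) : Prop :=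
  ∀ n : ℕ, ((B n).card : ℝ) ≤ (2 : ℝ) ^ ((n : ℝ) * ρ)

/-- `R`, `D`, `F` are unnormalized, at block length `N`.  The exponent `F` is achievable with `2 ^ R`
attempts if, at the rate `R / N` and the distortion `D / N` per letter, suitable sets of erasure
patterns have error probability at most `2 ^ (-n (F / N - ε))` for all large block lengths `n`,
for every `ε > 0`, whatever word is sent. -/
def ExponentAchievable (𝔽 : ℕ → Type*) [∀ n, Fintype (𝔽 n)] [∀ n, DecidableEq (𝔽 n)]
    (p : ℝ) (N : ℕ) (R D F : ℝ) : Prop :=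
  ∃ B : ∀ n : ℕ, Finset (Fin n → Fin 2), HasRate (R / N) B ∧
    ∀ ε : ℝ, 0 < ε → ∀ᶠ n : ℕ in atTop, ∀ c : Fin n → 𝔽 n,
      errorProb p ((n : ℝ) * (D / N)) (B n) c ≤ (2 : ℝ) ^ (-((n : ℝ) * (F / N - ε)))

/-- No choice of at most `2 ^ R` attempts beats the exponent `F`: for every choice of the sets of
erasure patterns and every `ε > 0`, the error probability is at least `2 ^ (-n (F / N + ε))` for all
large block lengths `n`. -/
def ExponentConverse (𝔽 : ℕ → Type*) [∀ n, Fintype (𝔽 n)] [∀ n, DecidableEq (𝔽 n)]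
    (p : ℝ) (N : ℕ) (R D F : ℝ) : Prop :=
  ∀ B : ∀ n : ℕ, Finset (Fin n → Fin 2), HasRate (R / N) B →
    ∀ ε : ℝ, 0 < ε → ∀ᶠ n : ℕ in atTop, ∀ c : Fin n → 𝔽 n,
      (2 : ℝ) ^ (-((n : ℝ) * (F / N + ε))) ≤ errorProb p ((n : ℝ) * (D / N)) (B n) c

end

/-!
Identify a pattern with the set of positions where it is `1`. The distortion of an error pattern
`s` and an erasure pattern `t` is then the number of errors `#sᶜ` plus the Hamming distance
`#(s ∆ t)`, so within the layer `#s = u n` distortion at most `n d` means Hamming distance at most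
`σ n`, where `σ = u + d - 1`.

Achievability: about `2 ^ (n (H u - H σ))` Hamming balls of radius `σ n` cover the layer, since a
random translate of one well-chosen `t` is that close to a given `s` with probability about
`2 ^ (-n (H u - H σ))`. A larger `s` is even easier to match, so `h u = R / N` attempts suffice for
all patterns with at least `u n` correct positions, and the Chernoff bound gives the exponent.

Converse: at a bias `v` slightly below `u`, too few balls of size `2 ^ (n H (v + d - 1))` are
available to cover even half of the layer `#s = v n`, whose probability is about
`2 ^ (-n D_KL (v ‖ p))`.
-/

noncomputable section

open Finset Topology
open scoped symmDiff Pointwise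

section Growth

lemma le_log_factorial (m : ℕ) : m * Real.log m - m ≤ Real.log m.factorial := by
  rcases eq_or_ne m 0 with rfl | hm
  · simp
  have hm1 : (1 : ℝ) ≤ m := mod_cast Nat.one_le_iff_ne_zero.mpr hm
  have hlog : 0 ≤ Real.log m := Real.log_nonneg hm1
  have hlog_pi : 0 ≤ Real.log (2 * Real.pi) := Real.log_nonneg (by linarith [Real.pi_gt_three])
  linarith [Stirling.le_log_factorial_stirling hm]

lemma log_factorial_le (m : ℕ) : Real.log m.factorial ≤ m * Real.log m - m + (1 + √m) := by
  rcases m with _ | m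
  · simp
  have hm : (0 : ℝ) < (m + 1 : ℕ) := by positivity
  have hanti : Real.log (Stirling.stirlingSeq (m + 1)) ≤ Real.log (Stirling.stirlingSeq 1) :=
    Stirling.log_stirlingSeq'_antitone m.zero_le
  rw [Stirling.stirlingSeq_one, Stirling.log_stirlingSeq_formula,
    Real.log_mul two_ne_zero hm.ne', Real.log_div hm.ne' (Real.exp_pos 1).ne',
    Real.log_div (Real.exp_pos 1).ne' (by positivity), Real.log_exp,
    Real.log_sqrt zero_le_two] at hanti
  have hsqrt : Real.log (m + 1 : ℕ) / 2 ≤ √(m + 1 : ℕ) := by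
    rw [← Real.log_sqrt hm.le]
    exact Real.log_le_self (Real.sqrt_nonneg _)
  linarith

lemma tendsto_log_factorial_div {k : ℕ → ℕ} {u : ℝ}
    (hk : Tendsto (fun n ↦ (k n : ℝ) / n) atTop (𝓝 u)) :
    Tendsto (fun n : ℕ ↦ (Real.log (k n).factorial - k n * Real.log n) / n) atTop
      (𝓝 (-u.negMulLog - u)) := by
  have herr : Tendsto (fun n : ℕ ↦
      (Real.log (k n).factorial - (k n * Real.log (k n) - k n)) / n) atTop (𝓝 0) := by
    have hinv : Tendsto (fun n : ℕ ↦ (n : ℝ)⁻¹) atTop (𝓝 0) := tendsto_inv_atTop_nhds_zero_nat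
    have hbound : Tendsto (fun n : ℕ ↦ (n : ℝ)⁻¹ + √(k n / n) * √(n : ℝ)⁻¹) atTop (𝓝 0) := by
      simpa using hinv.add (hk.sqrt.mul hinv.sqrt)
    refine squeeze_zero (fun n ↦ div_nonneg (sub_nonneg.mpr (le_log_factorial _)) n.cast_nonneg)
      (fun n ↦ ?_) hbound
    have hsqrt : √(k n / n) * √(n : ℝ)⁻¹ = √(k n) / n := by
      rw [← Real.sqrt_mul (by positivity), ← div_eq_mul_inv, div_div,
        Real.sqrt_div (Nat.cast_nonneg _), Real.sqrt_mul_self (Nat.cast_nonneg _)]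
    rw [hsqrt, ← one_div, ← add_div]
    gcongr
    linarith [log_factorial_le (k n)]
  have hmain := (herr.sub ((Real.continuous_negMulLog.tendsto u).comp hk)).sub hk
  rw [zero_sub] at hmain
  refine hmain.congr' ?_
  filter_upwards [eventually_ne_atTop 0] with n hn
  have hn0 : (n : ℝ) ≠ 0 := mod_cast hn
  rcases eq_or_ne (k n) 0 with hk0 | hk0
  · simp [hk0]
  · have hk0' : (k n : ℝ) ≠ 0 := mod_cast hk0
    simp only [Function.comp_apply, Real.negMulLog, Real.log_div hk0' hn0]
    field_simp
    ring

lemma tendsto_natCast_sub_div {m j : ℕ → ℕ} {a b : ℝ} (hjm : ∀ᶠ n in atTop, j n ≤ m n)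
    (hm : Tendsto (fun n ↦ (m n : ℝ) / n) atTop (𝓝 a))
    (hj : Tendsto (fun n ↦ (j n : ℝ) / n) atTop (𝓝 b)) :
    Tendsto (fun n ↦ ((m n - j n : ℕ) : ℝ) / n) atTop (𝓝 (a - b)) := by
  refine (hm.sub hj).congr' ?_
  filter_upwards [hjm] with n hn
  rw [Nat.cast_sub hn, sub_div]

lemma tendsto_log_choose_div {m j : ℕ → ℕ} {a x : ℝ} (hjm : ∀ᶠ n in atTop, j n ≤ m n)
    (hm : Tendsto (fun n ↦ (m n : ℝ) / n) atTop (𝓝 a))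
    (hj : Tendsto (fun n ↦ (j n : ℝ) / n) atTop (𝓝 (a * x))) :
    Tendsto (fun n : ℕ ↦ Real.log ((m n).choose (j n)) / n) atTop
      (𝓝 (a * Real.binEntropy x)) := by
  have hmain := ((tendsto_log_factorial_div hm).sub (tendsto_log_factorial_div hj)).sub
    (tendsto_log_factorial_div (tendsto_natCast_sub_div hjm hm hj))
  have hlim : -a.negMulLog - a - (-(a * x).negMulLog - a * x) -
      (-(a - a * x).negMulLog - (a - a * x)) = a * Real.binEntropy x := by
    rw [show a - a * x = a * (1 - x) by ring, Real.negMulLog_mul, Real.negMulLog_mul,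
      Real.binEntropy_eq_negMulLog_add_negMulLog_one_sub]
    ring
  rw [hlim] at hmain
  refine hmain.congr' ?_
  filter_upwards [hjm] with n hn
  have hfact (l : ℕ) : (l.factorial : ℝ) ≠ 0 := mod_cast l.factorial_ne_zero
  rw [Nat.cast_choose ℝ hn, Real.log_div (hfact _) (mul_ne_zero (hfact _) (hfact _)),
    Real.log_mul (hfact _) (hfact _), Nat.cast_sub hn]
  ring

lemma eventually_exp_mul_le {f : ℕ → ℝ} {c L : ℝ} (hf : ∀ᶠ n in atTop, 0 < f n)
    (h : Tendsto (fun n : ℕ ↦ Real.log (f n) / n) atTop (𝓝 L)) (hc : c < L) :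
    ∀ᶠ n : ℕ in atTop, Real.exp (n * c) ≤ f n := by
  filter_upwards [hf, h.eventually_const_lt hc, eventually_gt_atTop 0] with n hfn hn hn0
  rw [← Real.le_log_iff_exp_le hfn, mul_comm]
  exact ((lt_div_iff₀ (by exact_mod_cast hn0)).mp hn).le

lemma eventually_le_exp_mul {f : ℕ → ℝ} {c L : ℝ} (hf : ∀ᶠ n in atTop, 0 < f n)
    (h : Tendsto (fun n : ℕ ↦ Real.log (f n) / n) atTop (𝓝 L)) (hc : L < c) :
    ∀ᶠ n : ℕ in atTop, f n ≤ Real.exp (n * c) := by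
  filter_upwards [hf, h.eventually_lt_const hc, eventually_gt_atTop 0] with n hfn hn hn0
  rw [← Real.log_le_iff_le_exp hfn, mul_comm]
  exact ((div_lt_iff₀ (by exact_mod_cast hn0)).mp hn).le

lemma eventually_add_one_mul_exp_le {a b : ℝ} (hab : a < b) :
    ∀ᶠ n : ℕ in atTop, ((n : ℝ) + 1) * Real.exp (n * a) ≤ Real.exp (n * b) := by
  have hc : 0 < b - a := sub_pos.mpr hab
  have hlinear : ∀ᶠ n : ℕ in atTop, (n : ℝ) + 1 ≤ Real.exp (n * (b - a)) := by
    filter_upwards [tendsto_natCast_atTop_atTop.eventually_ge_atTop (2 / (b - a) ^ 2)] with n hn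
    rw [div_le_iff₀ (by positivity)] at hn
    have hexp := Real.quadratic_le_exp_of_nonneg (show 0 ≤ n * (b - a) by positivity)
    nlinarith [mul_le_mul_of_nonneg_left hn (Nat.cast_nonneg (α := ℝ) n),
      mul_nonneg (Nat.cast_nonneg (α := ℝ) n) hc.le]
  filter_upwards [hlinear] with n hn
  calc ((n : ℝ) + 1) * Real.exp (n * a) ≤ Real.exp (n * (b - a)) * Real.exp (n * a) := by gcongr
    _ = Real.exp (n * b) := by rw [← Real.exp_add]; ring_nf

lemma tendsto_floor_mul_div {v : ℝ} (hv : 0 ≤ v) :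
    Tendsto (fun n : ℕ ↦ (⌊v * n⌋₊ : ℝ) / n) atTop (𝓝 v) :=
  (tendsto_nat_floor_mul_div_atTop hv).comp tendsto_natCast_atTop_atTop

lemma tendsto_ceil_mul_div {v : ℝ} (hv : 0 ≤ v) :
    Tendsto (fun n : ℕ ↦ (⌈v * n⌉₊ : ℝ) / n) atTop (𝓝 v) :=
  (tendsto_nat_ceil_mul_div_atTop hv).comp tendsto_natCast_atTop_atTop

lemma tendsto_natCast_div_self : Tendsto (fun n : ℕ ↦ (n : ℝ) / n) atTop (𝓝 1) :=
  tendsto_const_nhds.congr' <| by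
    filter_upwards [eventually_ne_atTop 0] with n hn using (div_self (mod_cast hn)).symm

lemma eventually_le_of_tendsto_div {j k : ℕ → ℕ} {a b : ℝ} (hab : a < b)
    (hj : Tendsto (fun n ↦ (j n : ℝ) / n) atTop (𝓝 a))
    (hk : Tendsto (fun n ↦ (k n : ℝ) / n) atTop (𝓝 b)) :
    ∀ᶠ n in atTop, j n ≤ k n := by
  filter_upwards [hj.eventually_lt hk hab, eventually_gt_atTop 0] with n hlt hn
  exact_mod_cast ((div_lt_div_iff_of_pos_right (by exact_mod_cast hn)).mp hlt).le

end Growth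

section Bernoulli

variable {α : Type*} [Fintype α] [DecidableEq α]

/-- The probability of `s` when each element is selected independently with probability `p`. -/
def bernoulliWeight (p : ℝ) (s : Finset α) : ℝ := p ^ #s * (1 - p) ^ #sᶜ

lemma bernoulliWeight_nonneg {p : ℝ} (hp0 : 0 ≤ p) (hp1 : p ≤ 1) (s : Finset α) :
    0 ≤ bernoulliWeight p s :=
  mul_nonneg (pow_nonneg hp0 _) (pow_nonneg (sub_nonneg.mpr hp1) _)

lemma sum_bernoulliWeight (p : ℝ) : ∑ s : Finset α, bernoulliWeight p s = 1 := by
  simpa [bernoulliWeight, card_compl] using Fintype.sum_pow_mul_eq_add_pow α p (1 - p)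

lemma sum_bernoulliWeight_le_one {p : ℝ} (hp0 : 0 ≤ p) (hp1 : p ≤ 1) (S : Finset (Finset α)) :
    ∑ s ∈ S, bernoulliWeight p s ≤ 1 :=
  (sum_le_sum_of_subset_of_nonneg (subset_univ S) fun s _ _ ↦
    bernoulliWeight_nonneg hp0 hp1 s).trans_eq (sum_bernoulliWeight p)

lemma pow_mul_pow_card_compl_le {a b v : ℝ} (ha : 0 < a) (hb : 0 < b) (hv0 : 0 < v) (hv1 : v < 1)
    (hab : v * b ≤ (1 - v) * a) {s : Finset α} (hs : (#s : ℝ) ≤ v * Fintype.card α) :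
    a ^ #s * b ^ #sᶜ ≤
      Real.exp (Fintype.card α * (Real.binEntropy v + v * Real.log a + (1 - v) * Real.log b)) *
        bernoulliWeight v s := by
  have hw : 0 < 1 - v := sub_pos.mpr hv1
  have hcompl : (#sᶜ : ℝ) = Fintype.card α - #s := by
    rw [card_compl, Nat.cast_sub (card_le_univ s)]
  have hlog : Real.log v + Real.log b ≤ Real.log (1 - v) + Real.log a := by
    rw [← Real.log_mul hv0.ne' hb.ne', ← Real.log_mul hw.ne' ha.ne']
    exact Real.log_le_log (by positivity) hab
  -- Change of measure: by `hab` the ratio of the two weights is monotone in `#s`, hence largest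
  -- when `#s` is `v * Fintype.card α`, where its value is the exponential factor.
  unfold bernoulliWeight
  rw [← Real.log_le_log_iff (by positivity) (by positivity),
    Real.log_mul (by positivity) (by positivity), Real.log_mul (by positivity) (by positivity),
    Real.log_mul (by positivity) (by positivity), Real.log_exp, Real.log_pow, Real.log_pow,
    Real.log_pow, Real.log_pow, hcompl, Real.binEntropy, Real.log_inv, Real.log_inv]
  nlinarith [mul_nonneg (sub_nonneg.mpr hs) (sub_nonneg.mpr hlog)]

lemma sum_pow_mul_pow_card_compl_le {a b v : ℝ} (ha : 0 < a) (hb : 0 < b) (hv0 : 0 < v)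
    (hv1 : v < 1) (hab : v * b ≤ (1 - v) * a) :
    ∑ s : Finset α with (#s : ℝ) ≤ v * Fintype.card α, a ^ #s * b ^ #sᶜ ≤
      Real.exp
        (Fintype.card α * (Real.binEntropy v + v * Real.log a + (1 - v) * Real.log b)) := by
  refine (sum_le_sum fun s hs ↦
    pow_mul_pow_card_compl_le ha hb hv0 hv1 hab (mem_filter.mp hs).2).trans ?_
  rw [← mul_sum]
  exact mul_le_of_le_one_right (Real.exp_pos _).le (sum_bernoulliWeight_le_one hv0.le hv1.le _)

lemma klBits_mul_log_two {u p : ℝ} (hp0 : p ≠ 0) (hp1 : p ≠ 1) :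
    klBits u p * Real.log 2 =
      -(Real.binEntropy u + u * Real.log p + (1 - u) * Real.log (1 - p)) := by
  have hlog_div {x y : ℝ} (hy : y ≠ 0) :
      x * Real.log (x / y) = x * (Real.log x - Real.log y) := by
    rcases eq_or_ne x 0 with rfl | hx
    · simp
    · rw [Real.log_div hx hy]
  have hlog_two : Real.log 2 ≠ 0 := (Real.log_pos one_lt_two).ne'
  rw [klBits, Real.logb, Real.logb, add_mul, mul_assoc, mul_assoc, div_mul_cancel₀ _ hlog_two,
    div_mul_cancel₀ _ hlog_two, hlog_div hp0, hlog_div (sub_ne_zero.mpr hp1.symm),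
    Real.binEntropy, Real.log_inv, Real.log_inv]
  ring

lemma two_rpow_eq_exp (x : ℝ) : (2 : ℝ) ^ x = Real.exp (x * Real.log 2) := by
  rw [Real.rpow_def_of_pos two_pos, mul_comm]

lemma sum_bernoulliWeight_card_le {v p : ℝ} (hv : 0 < v) (hvp : v ≤ p) (hp : p < 1) :
    ∑ s : Finset α with (#s : ℝ) ≤ v * Fintype.card α, bernoulliWeight p s ≤
      (2 : ℝ) ^ (-(Fintype.card α * klBits v p)) := by
  have hp0 : 0 < p := hv.trans_le hvp
  rw [two_rpow_eq_exp, neg_mul, mul_assoc, klBits_mul_log_two hp0.ne' hp.ne, mul_neg, neg_neg]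
  exact sum_pow_mul_pow_card_compl_le hp0 (sub_pos.mpr hp) hv (hvp.trans_lt hp) (by linarith)

lemma card_hammingBall_le {σ : ℝ} (h0 : 0 < σ) (h1 : σ ≤ 1 / 2) (t : Finset α) :
    (#{s : Finset α | (#(s ∆ t) : ℝ) ≤ σ * Fintype.card α} : ℝ) ≤
      Real.exp (Fintype.card α * Real.binEntropy σ) := by
  have htranslate : #{s : Finset α | (#(s ∆ t) : ℝ) ≤ σ * Fintype.card α} ≤
      #{s : Finset α | (#s : ℝ) ≤ σ * Fintype.card α} :=
    card_le_card_of_injOn (· ∆ t) (fun s hs ↦ by simpa using hs) (symmDiff_left_injective t).injOn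
  refine (Nat.cast_le.mpr htranslate).trans ?_
  simpa using sum_pow_mul_pow_card_compl_le (α := α) one_pos one_pos h0 (by linarith) (by linarith)

lemma tendsto_log_binomial_div {k : ℕ → ℕ} {v p : ℝ} (hp0 : 0 < p) (hp1 : p < 1)
    (hkn : ∀ᶠ n in atTop, k n ≤ n) (hk : Tendsto (fun n ↦ (k n : ℝ) / n) atTop (𝓝 v)) :
    Tendsto (fun n : ℕ ↦ Real.log (n.choose (k n) * (p ^ k n * (1 - p) ^ (n - k n))) / n) atTop
      (𝓝 (-(klBits v p * Real.log 2))) := by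
  have : 0 < 1 - p := sub_pos.mpr hp1
  have hmain := (tendsto_log_choose_div hkn tendsto_natCast_div_self (by simpa using hk)).add
    ((hk.mul_const (Real.log p)).add
      ((tendsto_natCast_sub_div hkn tendsto_natCast_div_self hk).mul_const (Real.log (1 - p))))
  rw [klBits_mul_log_two hp0.ne' hp1.ne, neg_neg, add_assoc]
  rw [one_mul] at hmain
  refine hmain.congr' ?_
  filter_upwards [hkn] with n hn
  have hchoose : (0 : ℝ) < n.choose (k n) := mod_cast Nat.choose_pos hn
  rw [Real.log_mul hchoose.ne' (by positivity), Real.log_mul (by positivity) (by positivity),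
    Real.log_pow, Real.log_pow]
  ring

end Bernoulli

section Covering

lemma exists_card_not_covered_le {X Y : Type*} [Fintype X] [Fintype Y] [Nonempty Y]
    [DecidableEq Y] (r : X → Y → Prop) [DecidableRel r] {q : ℝ}
    (hr : ∀ x, q * Fintype.card Y ≤ #{y | r x y}) (L : ℕ) :
    ∃ T : Finset Y, #T ≤ L ∧
      (#{x | ∀ y ∈ T, ¬ r x y} : ℝ) ≤ Real.exp (-(q * L)) * Fintype.card X := by
  induction L with
  | zero => exact ⟨∅, by simp⟩
  | succ L ih =>
    obtain ⟨T, hTL, hT⟩ := ih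
    set U : Finset X := {x | ∀ y ∈ T, ¬ r x y} with hU
    have hdouble : ∑ _ : Y, q * #U ≤ ∑ y, (#{x ∈ U | r x y} : ℝ) :=
      calc ∑ _, q * #U = ∑ _ ∈ U, q * Fintype.card Y := by simp; ring
        _ ≤ ∑ x ∈ U, (#{y | r x y} : ℝ) := sum_le_sum fun x _ ↦ hr x
        _ = ∑ y, (#{x ∈ U | r x y} : ℝ) := by
          exact_mod_cast sum_card_bipartiteAbove_eq_sum_card_bipartiteBelow r
    obtain ⟨y, -, hy⟩ := exists_le_of_sum_le univ_nonempty hdouble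
    refine ⟨insert y T, (card_insert_le _ _).trans (Nat.add_le_add_right hTL 1), ?_⟩
    have hinsert : ({x | ∀ z ∈ insert y T, ¬ r x z} : Finset X) = {x ∈ U | ¬ r x y} := by
      ext x
      simp [hU, and_comm]
    have hsplit : (#{x ∈ U | r x y} : ℝ) + #{x ∈ U | ¬ r x y} = #U :=
      mod_cast card_filter_add_card_filter_not (s := U) (r · y)
    rw [hinsert]
    calc (#{x ∈ U | ¬ r x y} : ℝ) ≤ (-q + 1) * #U := by linarith
      _ ≤ Real.exp (-q) * #U := by gcongr; exact Real.add_one_le_exp _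
      _ ≤ Real.exp (-q) * (Real.exp (-(q * L)) * Fintype.card X) := by gcongr
      _ = Real.exp (-(q * (L + 1 : ℕ))) * Fintype.card X := by
        rw [← mul_assoc, ← Real.exp_add, Nat.cast_add_one]
        ring_nf

lemma exists_cover {X Y : Type*} [Fintype X] [Fintype Y] [Nonempty Y]
    (r : X → Y → Prop) [DecidableRel r] {q : ℝ} (hq : 0 < q)
    (hr : ∀ x, q * Fintype.card Y ≤ #{y | r x y}) :
    ∃ T : Finset Y, (#T : ℝ) ≤ Real.log (Fintype.card X) / q + 1 ∧ ∀ x, ∃ y ∈ T, r x y := by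
  classical
  have hlog : 0 ≤ Real.log (Fintype.card X) / q := by positivity
  obtain ⟨T, hTL, hT⟩ :=
    exists_card_not_covered_le r hr (⌊Real.log (Fintype.card X) / q⌋₊ + 1)
  refine ⟨T, ?_, fun x ↦ ?_⟩
  · have hTL' : (#T : ℝ) ≤ ⌊Real.log (Fintype.card X) / q⌋₊ + 1 := mod_cast hTL
    linarith [Nat.floor_le hlog]
  · have hL := Nat.lt_floor_add_one (Real.log (Fintype.card X) / q)
    rw [div_lt_iff₀' hq] at hL
    have hX : (0 : ℝ) < Fintype.card X := mod_cast Fintype.card_pos_iff.mpr ⟨x⟩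
    have hlt : Real.exp (-(q * (⌊Real.log (Fintype.card X) / q⌋₊ + 1 : ℕ))) * Fintype.card X
        < 1 := by
      rw [Real.exp_neg, inv_mul_lt_one₀ (Real.exp_pos _), ← Real.log_lt_iff_lt_exp hX]
      exact_mod_cast hL
    have hzero : #{x | ∀ y ∈ T, ¬ r x y} = 0 :=
      Nat.lt_one_iff.mp (by exact_mod_cast hT.trans_lt hlt)
    have hx := filter_eq_empty_iff.mp (card_eq_zero.mp hzero) (mem_univ x)
    push Not at hx
    exact hx

section MulAction

variable {G X : Type*} [Group G] [Fintype X] [MulAction G X] [MulAction.IsPretransitive G X]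

lemma card_smul_mem_mul_card [Fintype G] [DecidableEq X] (A : Finset X) (x : X) :
    #{g : G | g • x ∈ A} * Fintype.card X = Fintype.card G * #A := by
  have hconst (x' : X) : #{g : G | g • x' ∈ A} = #{g : G | g • x ∈ A} := by
    obtain ⟨h, rfl⟩ := MulAction.exists_smul_eq G x x'
    exact card_equiv (Equiv.mulRight h) fun g ↦ by simp [mul_smul]
  have htranslate (g : G) : #{x | g • x ∈ A} = #A :=
    card_equiv (MulAction.toPerm g) fun x ↦ by simp
  calc #{g : G | g • x ∈ A} * Fintype.card X = ∑ x', #{g : G | g • x' ∈ A} := by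
        simp [hconst, mul_comm]
    _ = ∑ g : G, #{x | g • x ∈ A} :=
      sum_card_bipartiteAbove_eq_sum_card_bipartiteBelow fun x (g : G) ↦ g • x ∈ A
    _ = Fintype.card G * #A := by simp [htranslate]

lemma exists_smul_cover [Finite G] {A : Finset X} (hA : A.Nonempty) :
    ∃ T : Finset G, (#T : ℝ) ≤ (Real.log (Fintype.card X) + 1) * (Fintype.card X / #A) ∧
      ∀ x, ∃ g ∈ T, g • x ∈ A := by
  classical
  cases nonempty_fintype G
  have hA0 : (0 : ℝ) < #A := mod_cast hA.card_pos
  have hAX : (#A : ℝ) ≤ Fintype.card X := mod_cast card_le_univ A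
  have hX : (0 : ℝ) < Fintype.card X := hA0.trans_le hAX
  obtain ⟨T, hT, hcover⟩ := exists_cover (fun x (g : G) ↦ g • x ∈ A)
    (q := #A / Fintype.card X) (by positivity) fun x ↦ by
      rw [div_mul_eq_mul_div, div_le_iff₀ hX, mul_comm]
      exact_mod_cast (card_smul_mem_mul_card (G := G) A x).ge
  refine ⟨T, hT.trans ?_, hcover⟩
  calc Real.log (Fintype.card X) / (#A / Fintype.card X) + 1
      ≤ Real.log (Fintype.card X) / (#A / Fintype.card X) + Fintype.card X / #A := by
        gcongr
        rwa [one_le_div hA0]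
    _ = (Real.log (Fintype.card X) + 1) * (Fintype.card X / #A) := by
      field_simp

end MulAction

section Layer

variable {α : Type*} [Fintype α] [DecidableEq α]

lemma card_filter_card_sdiff (t : Finset α) (i j : ℕ) :
    #{s : Finset α | #(t \ s) = i ∧ #(s \ t) = j} = (#t).choose i * (#tᶜ).choose j := by
  rw [← card_powersetCard, ← card_powersetCard, ← card_product]
  have hinv {v w : Finset α} (hv : v ⊆ t) (hw : w ⊆ tᶜ) :
      t \ (t \ v ∪ w) = v ∧ (t \ v ∪ w) \ t = w := by
    constructor <;> grind [mem_compl]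
  refine card_nbij' (fun s ↦ (t \ s, s \ t)) (fun vw ↦ t \ vw.1 ∪ vw.2) ?_ ?_ ?_ ?_
  · intro s hs
    simpa [subset_compl_iff_disjoint_right, disjoint_sdiff_self_left] using hs
  · rintro ⟨v, w⟩ hvw
    simp only [mem_coe, mem_product, mem_powersetCard, mem_filter_univ] at hvw ⊢
    obtain ⟨⟨hv, hvi⟩, hw, hwj⟩ := hvw
    simpa only [hinv hv hw] using ⟨hvi, hwj⟩
  · intro s _
    grind
  · rintro ⟨v, w⟩ hvw
    simp only [mem_coe, mem_product, mem_powersetCard] at hvw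
    simp only [hinv hvw.1.1 hvw.2.1]

lemma exists_layer_cover {w i j k : ℕ} (hiw : i ≤ w) (hjw : w + j ≤ Fintype.card α)
    (hk : k + i = w + j) :
    ∃ T : Finset (Finset α),
      (#T : ℝ) ≤ (Real.log ((Fintype.card α).choose k) + 1) *
        ((Fintype.card α).choose k / (w.choose i * (Fintype.card α - w).choose j)) ∧
      ∀ s, #s = k → ∃ t ∈ T, #(s ∆ t) ≤ i + j := by
  obtain ⟨t₀, -, ht₀⟩ := exists_subset_card_eq (s := (univ : Finset α)) (n := w)
    (by rw [card_univ]; omega)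
  let S : Finset (Finset α) := {s | #(t₀ \ s) = i ∧ #(s \ t₀) = j}
  have hSk {s : Finset α} (hs : s ∈ S) : #s = k := by
    have := card_sdiff_add_card_inter s t₀
    have := card_sdiff_add_card_inter t₀ s
    have := inter_comm s t₀
    grind
  let A : Finset (Set.powersetCard α k) := {s | (s : Finset α) ∈ S}
  have hA : #A = w.choose i * (Fintype.card α - w).choose j := by
    rw [← ht₀, ← card_compl, ← card_filter_card_sdiff]
    exact card_nbij Subtype.val (fun s hs ↦ by simpa [A, S] using hs)
      Subtype.val_injective.injOn fun s hs ↦ ⟨⟨s, hSk hs⟩, by simpa [A, S] using hs, rfl⟩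
  have hApos : A.Nonempty := by
    rw [← card_pos, hA]
    exact Nat.mul_pos (Nat.choose_pos hiw) (Nat.choose_pos (by omega))
  have : MulAction.IsPretransitive (Equiv.Perm α) (Set.powersetCard α k) :=
    Set.powersetCard.isPretransitive
  obtain ⟨P, hP, hcover⟩ := exists_smul_cover (G := Equiv.Perm α) hApos
  rw [hA, ← Nat.card_eq_fintype_card, Set.powersetCard.card, Nat.card_eq_fintype_card] at hP
  refine ⟨P.image (·⁻¹ • t₀), (Nat.cast_le.mpr card_image_le).trans (by exact_mod_cast hP), ?_⟩
  intro s hs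
  obtain ⟨g, hg, hgs⟩ := hcover ⟨s, hs⟩
  refine ⟨g⁻¹ • t₀, mem_image_of_mem _ hg, ?_⟩
  simp only [A, S, mem_filter_univ, Set.powersetCard.coe_smul] at hgs
  calc #(s ∆ (g⁻¹ • t₀)) = #((g • s) ∆ t₀) := by
        rw [← card_smul_finset g, Finset.smul_finset_symmDiff, smul_inv_smul]
    _ ≤ #((g • s) \ t₀) + #(t₀ \ (g • s)) := card_union_le _ _
    _ = i + j := by rw [hgs.1, hgs.2, add_comm]

end Layer

lemma tendsto_log_layerCover_div {w i j k : ℕ → ℕ} {ω σ u : ℝ}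
    (hiw : ∀ᶠ n in atTop, i n ≤ w n) (hjw : ∀ᶠ n in atTop, w n + j n ≤ n)
    (hkn : ∀ᶠ n in atTop, k n ≤ n)
    (hw : Tendsto (fun n ↦ (w n : ℝ) / n) atTop (𝓝 ω))
    (hi : Tendsto (fun n ↦ (i n : ℝ) / n) atTop (𝓝 (ω * σ)))
    (hj : Tendsto (fun n ↦ (j n : ℝ) / n) atTop (𝓝 ((1 - ω) * σ)))
    (hk : Tendsto (fun n ↦ (k n : ℝ) / n) atTop (𝓝 u)) :
    Tendsto (fun n : ℕ ↦
      Real.log (n.choose (k n) / ((w n).choose (i n) * (n - w n).choose (j n))) / n) atTop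
      (𝓝 (Real.binEntropy u - Real.binEntropy σ)) := by
  have hnw : Tendsto (fun n ↦ ((n - w n : ℕ) : ℝ) / n) atTop (𝓝 (1 - ω)) :=
    tendsto_natCast_sub_div (hjw.mono fun n hn ↦ by omega) tendsto_natCast_div_self hw
  have hmain := (tendsto_log_choose_div hkn tendsto_natCast_div_self (by simpa using hk)).sub
    ((tendsto_log_choose_div hiw hw hi).add
      (tendsto_log_choose_div (hjw.mono fun n hn ↦ by omega) hnw hj))
  rw [one_mul, ← add_mul, add_sub_cancel, one_mul] at hmain
  refine hmain.congr' ?_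
  filter_upwards [hiw, hjw, hkn] with n hiw hjw hkn
  have hC : (n.choose (k n) : ℝ) ≠ 0 := mod_cast (Nat.choose_pos hkn).ne'
  have hCi : ((w n).choose (i n) : ℝ) ≠ 0 := mod_cast (Nat.choose_pos hiw).ne'
  have hCj : ((n - w n).choose (j n) : ℝ) ≠ 0 := mod_cast (Nat.choose_pos (by omega)).ne'
  rw [Real.log_div hC (mul_ne_zero hCi hCj), Real.log_mul hCi hCj, sub_div, add_div]

lemma log_choose_le (n k : ℕ) : Real.log (n.choose k) ≤ n := by
  have hchoose : (n.choose k : ℝ) ≤ 2 ^ n := mod_cast Nat.choose_le_two_pow n k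
  rcases (n.choose k).eq_zero_or_pos with h0 | hpos
  · simp [h0]
  · calc Real.log (n.choose k) ≤ Real.log (2 ^ n) := Real.log_le_log (mod_cast hpos) hchoose
      _ = n * Real.log 2 := by rw [Real.log_pow]
      _ ≤ n := mul_le_of_le_one_right n.cast_nonneg (by linarith [Real.log_two_lt_d9])

lemma eventually_exists_layerCover {w i j k : ℕ → ℕ} {ω σ u ρ : ℝ}
    (hiw : ∀ᶠ n in atTop, i n ≤ w n) (hjw : ∀ᶠ n in atTop, w n + j n ≤ n)
    (hki : ∀ᶠ n in atTop, k n + i n = w n + j n)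
    (hw : Tendsto (fun n ↦ (w n : ℝ) / n) atTop (𝓝 ω))
    (hi : Tendsto (fun n ↦ (i n : ℝ) / n) atTop (𝓝 (ω * σ)))
    (hj : Tendsto (fun n ↦ (j n : ℝ) / n) atTop (𝓝 ((1 - ω) * σ)))
    (hk : Tendsto (fun n ↦ (k n : ℝ) / n) atTop (𝓝 u))
    (hρ : Real.binEntropy u - Real.binEntropy σ < ρ) :
    ∀ᶠ n : ℕ in atTop, ∃ T : Finset (Finset (Fin n)), (#T : ℝ) ≤ Real.exp (n * ρ) ∧
      ∀ s, #s = k n → ∃ t ∈ T, #(s ∆ t) ≤ i n + j n := by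
  have hkn : ∀ᶠ n in atTop, k n ≤ n := by
    filter_upwards [hjw, hki] with n hjw hki using by omega
  have hpos : ∀ᶠ n in atTop,
      (0 : ℝ) < n.choose (k n) / ((w n).choose (i n) * (n - w n).choose (j n)) := by
    filter_upwards [hiw, hjw, hkn] with n hiw hjw hkn
    have := Nat.choose_pos hkn
    have := Nat.choose_pos hiw
    have : 0 < (n - w n).choose (j n) := Nat.choose_pos (by omega)
    positivity
  obtain ⟨ρ', hρ', hρ'ρ⟩ := exists_between hρ
  filter_upwards [hiw, hjw, hki, eventually_add_one_mul_exp_le hρ'ρ,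
    eventually_le_exp_mul hpos (tendsto_log_layerCover_div hiw hjw hkn hw hi hj hk) hρ']
    with n hiw hjw hki hexp hratio
  obtain ⟨T, hT, hcover⟩ :=
    exists_layer_cover (α := Fin n) hiw (by rwa [Fintype.card_fin]) hki
  rw [Fintype.card_fin] at hT
  refine ⟨T, hT.trans (le_trans ?_ hexp), hcover⟩
  gcongr
  exact log_choose_le n (k n)

lemma exists_binarySymmetricChannel_input {σ u : ℝ} (hσu : σ ≤ u) (hu : σ + u ≤ 1)
    (hσ : σ < 1 / 2) : ∃ ω ∈ Set.Icc (0 : ℝ) 1, u = ω * (1 - σ) + (1 - ω) * σ := by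
  have hden : 0 < 1 - 2 * σ := by linarith
  refine ⟨(u - σ) / (1 - 2 * σ), ⟨div_nonneg (by linarith) hden.le,
    (div_le_one hden).mpr (by linarith)⟩, ?_⟩
  linear_combination -div_mul_cancel₀ (u - σ) hden.ne'

lemma eventually_exists_hammingCover {k : ℕ → ℕ} {σ u ρ : ℝ} (hσ0 : 0 ≤ σ) (hσu : σ < u)
    (hu : σ + u < 1) (hρ : Real.binEntropy u - Real.binEntropy σ < ρ)
    (hk : Tendsto (fun n ↦ (k n : ℝ) / n) atTop (𝓝 u)) :
    ∀ᶠ n : ℕ in atTop, ∃ T : Finset (Finset (Fin n)), (#T : ℝ) ≤ Real.exp (n * ρ) ∧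
      ∀ s, #s = k n → ∃ t ∈ T, (#(s ∆ t) : ℝ) ≤ σ * n := by
  -- A binary symmetric channel with crossover probability `σ` and input bias `ω` has output bias
  -- `u`; a typical pair `(t, s)` has `#(t \ s) ≈ ω σ n` and `#(s \ t) ≈ (1 - ω) σ n`.
  obtain ⟨ω, ⟨hω0, hω1⟩, hω⟩ :=
    exists_binarySymmetricChannel_input hσu.le hu.le (by linarith)
  have hωσ : 0 ≤ ω * σ := mul_nonneg hω0 hσ0
  have hω'σ : 0 ≤ (1 - ω) * σ := mul_nonneg (sub_nonneg.mpr hω1) hσ0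
  let i : ℕ → ℕ := fun n ↦ ⌊ω * σ * n⌋₊
  let j : ℕ → ℕ := fun n ↦ ⌊(1 - ω) * σ * n⌋₊
  have hi : Tendsto (fun n ↦ (i n : ℝ) / n) atTop (𝓝 (ω * σ)) := tendsto_floor_mul_div hωσ
  have hj : Tendsto (fun n ↦ (j n : ℝ) / n) atTop (𝓝 ((1 - ω) * σ)) :=
    tendsto_floor_mul_div hω'σ
  have hki : Tendsto (fun n ↦ ((k n + i n : ℕ) : ℝ) / n) atTop (𝓝 (u + ω * σ)) := by
    simpa only [Nat.cast_add, add_div] using hk.add hi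
  have hjk : ∀ᶠ n in atTop, j n ≤ k n := eventually_le_of_tendsto_div (by nlinarith) hj hk
  have hkin : ∀ᶠ n in atTop, k n + i n ≤ n :=
    eventually_le_of_tendsto_div (by nlinarith) hki tendsto_natCast_div_self
  have hw : Tendsto (fun n ↦ ((k n + i n - j n : ℕ) : ℝ) / n) atTop (𝓝 ω) := by
    have hlim : u + ω * σ - (1 - ω) * σ = ω := by linear_combination hω
    exact hlim ▸ tendsto_natCast_sub_div (hjk.mono fun n hn ↦ by omega) hki hj
  filter_upwards [eventually_exists_layerCover (hjk.mono fun n hn ↦ by omega)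
    ((hjk.and hkin).mono fun n hn ↦ by omega) (hjk.mono fun n hn ↦ by omega) hw hi hj hk hρ]
    with n ⟨T, hT, hcover⟩
  refine ⟨T, hT, fun s hs ↦ ?_⟩
  obtain ⟨t, ht, hst⟩ := hcover s hs
  refine ⟨t, ht, ?_⟩
  calc (#(s ∆ t) : ℝ) ≤ i n + j n := mod_cast hst
    _ ≤ ω * σ * n + (1 - ω) * σ * n :=
      add_le_add (Nat.floor_le (by positivity)) (Nat.floor_le (by positivity))
    _ = σ * n := by ring

end Covering

section RateFunction

lemma continuous_H₂ : Continuous H₂ := Real.binEntropy_continuous.div_const _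

lemma continuous_hRate (d : ℝ) : Continuous (hRate d) :=
  continuous_H₂.sub (continuous_H₂.comp (by fun_prop))

lemma hasDerivAt_H₂ {u : ℝ} (hu0 : u ≠ 0) (hu1 : u ≠ 1) :
    HasDerivAt H₂ ((Real.log (1 - u) - Real.log u) / Real.log 2) u :=
  (Real.hasDerivAt_binEntropy hu0 hu1).div_const _

lemma hRate_strictAntiOn {d : ℝ} (hd : d < 1) :
    StrictAntiOn (hRate d) (Set.Icc (1 - d) (1 - d / 2)) := by
  refine strictAntiOn_of_deriv_neg (convex_Icc _ _) (continuous_hRate d).continuousOn ?_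
  intro u hu
  rw [interior_Icc] at hu
  obtain ⟨hu1, hu2⟩ := hu
  have hu0 : 0 < u := by linarith
  have hσ0 : 0 < u + d - 1 := by linarith
  have hshift : HasDerivAt (fun x : ℝ ↦ x + d - 1) 1 u :=
    ((hasDerivAt_id u).add_const d).sub_const 1
  have hderiv := (hasDerivAt_H₂ hu0.ne' (by linarith)).sub
    ((hasDerivAt_H₂ hσ0.ne' (by linarith)).comp u hshift)
  rw [show deriv (hRate d) u = _ from hderiv.deriv, mul_one, ← sub_div]
  refine div_neg_of_neg_of_pos ?_ (Real.log_pos one_lt_two)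
  have hlog : Real.log (u + d - 1) < Real.log u := Real.log_lt_log hσ0 (by linarith)
  have hlog_compl : Real.log (1 - u) < Real.log (1 - (u + d - 1)) :=
    Real.log_lt_log (by linarith) (by linarith)
  linarith

lemma hRate_left (d : ℝ) : hRate d (1 - d) = H₂ (1 - d) := by
  simp [hRate, H₂]

lemma hRate_right (d : ℝ) : hRate d (1 - d / 2) = 0 := by
  rw [hRate, H₂, H₂, Real.binEntropy_one_sub, show 1 - d / 2 + d - 1 = d / 2 by ring, sub_self]

lemma hRate_bijOn {d : ℝ} (h0 : 0 < d) (h1 : d < 1) :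
    Set.BijOn (hRate d) (hDomain d) (Set.Ioc 0 (H₂ (1 - d))) := by
  have hanti := hRate_strictAntiOn h1
  have hle : 1 - d ≤ 1 - d / 2 := by linarith
  refine ⟨?_, (hanti.mono Set.Ico_subset_Icc_self).injOn, ?_⟩
  · rintro u ⟨hu1, hu2⟩
    constructor
    · rw [← hRate_right d]
      exact hanti ⟨hu1, hu2.le⟩ ⟨hle, le_rfl⟩ hu2
    · rw [← hRate_left d]
      exact hanti.antitoneOn ⟨le_rfl, hle⟩ ⟨hu1, hu2.le⟩ hu1
  · rw [← hRate_left, ← hRate_right d]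
    exact intermediate_value_Ico' hle (continuous_hRate d).continuousOn

lemma hRate_mul_log_two (d u : ℝ) :
    hRate d u * Real.log 2 = Real.binEntropy u - Real.binEntropy (u + d - 1) := by
  have : Real.log 2 ≠ 0 := (Real.log_pos one_lt_two).ne'
  unfold hRate H₂
  field_simp

lemma hInv_mem {d r : ℝ} (h0 : 0 < d) (h1 : d < 1) (hr : r ∈ Set.Ioc 0 (H₂ (1 - d))) :
    hInv d r ∈ hDomain d :=
  Function.invFunOn_mem ((hRate_bijOn h0 h1).surjOn hr)

lemma hRate_hInv {d r : ℝ} (h0 : 0 < d) (h1 : d < 1) (hr : r ∈ Set.Ioc 0 (H₂ (1 - d))) :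
    hRate d (hInv d r) = r :=
  Function.invFunOn_eq ((hRate_bijOn h0 h1).surjOn hr)

lemma klBits_self {p : ℝ} (hp0 : p ≠ 0) (hp1 : p ≠ 1) : klBits p p = 0 := by
  simp [klBits, div_self hp0, div_self (sub_ne_zero.mpr hp1.symm)]

lemma continuous_klBits {p : ℝ} (hp0 : p ≠ 0) (hp1 : p ≠ 1) : Continuous (klBits · p) := by
  have hklBits : (klBits · p) = fun u ↦
      -(Real.binEntropy u + u * Real.log p + (1 - u) * Real.log (1 - p)) / Real.log 2 := by
    funext u
    rw [← klBits_mul_log_two hp0 hp1, mul_div_cancel_right₀ _ (Real.log_pos one_lt_two).ne']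
  rw [hklBits]
  have := Real.binEntropy_continuous
  fun_prop

end RateFunction

section Miss

variable {α : Type*} [Fintype α] [DecidableEq α]

open Classical in
/-- The sets of correct positions which, with `T` as the family of sets of unerased positions, are
not within distortion `D`; by `distortion_eq`, the distortion of `s` and `t` is
`#sᶜ + #(s ∆ t)`. -/
def uncovered (D : ℝ) (T : Finset (Finset α)) : Finset (Finset α) :=
  {s | ∀ t ∈ T, D < #sᶜ + #(s ∆ t)}

/-- The probability that a random set of correct positions, containing each position independently
with probability `p`, is not within distortion `D` of `T`. -/
def missProb (p D : ℝ) (T : Finset (Finset α)) : ℝ := ∑ s ∈ uncovered D T, bernoulliWeight p s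

lemma mem_uncovered {D : ℝ} {T : Finset (Finset α)} {s : Finset α} :
    s ∈ uncovered D T ↔ ∀ t ∈ T, D < #sᶜ + #(s ∆ t) := by
  classical exact mem_filter_univ _

lemma missProb_le_one {p : ℝ} (hp0 : 0 ≤ p) (hp1 : p ≤ 1) (D : ℝ) (T : Finset (Finset α)) :
    missProb p D T ≤ 1 :=
  sum_bernoulliWeight_le_one hp0 hp1 _

lemma card_compl_add_card_symmDiff_anti {s s' : Finset α} (hs : s' ⊆ s) (t : Finset α) :
    #sᶜ + #(s ∆ t) ≤ #s'ᶜ + #(s' ∆ t) := by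
  have htriangle : #(s ∆ t) ≤ #(s ∆ s') + #(s' ∆ t) :=
    (card_le_card (symmDiff_triangle s s' t)).trans (card_union_le _ _)
  have hsdiff : #(s ∆ s') + #s' = #s := by
    rw [symmDiff_of_ge hs, card_sdiff_add_card_eq_card hs]
  have := card_compl_add_card s
  have := card_compl_add_card s'
  omega

end Miss

section Channel

lemma sum_prod_mSC {𝔽 ι : Type*} [Fintype 𝔽] [DecidableEq 𝔽] [Nontrivial 𝔽] [Fintype ι]
    [DecidableEq ι] (p : ℝ) (c : ι → 𝔽) (s : Finset ι) :
    ∑ r : ι → 𝔽 with ({i | r i = c i} : Finset ι) = s, ∏ i, mSC 𝔽 p (c i) (r i) =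
      bernoulliWeight p s := by
  let letters (i : ι) : Finset 𝔽 := if i ∈ s then {c i} else {c i}ᶜ
  have hset : ({r : ι → 𝔽 | ({i | r i = c i} : Finset ι) = s} : Finset _) =
      Fintype.piFinset letters := by
    ext r
    simp only [mem_filter_univ, Fintype.mem_piFinset, Finset.ext_iff]
    refine forall_congr' fun i ↦ ?_
    by_cases hi : i ∈ s <;> simp [letters, hi]
  have hletter (i : ι) : ∑ a ∈ letters i, mSC 𝔽 p (c i) a = if i ∈ s then p else 1 - p := by
    simp only [letters]
    split_ifs
    · simp [mSC]
    · have hcard : (1 : ℝ) < Fintype.card 𝔽 := mod_cast Fintype.one_lt_card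
      have hwrong : ∀ a ∈ ({c i}ᶜ : Finset 𝔽),
          mSC 𝔽 p (c i) a = (1 - p) / ((Fintype.card 𝔽 : ℝ) - 1) :=
        fun a ha ↦ if_neg (by simpa using ha)
      rw [sum_congr rfl hwrong, sum_const, card_compl, card_singleton, nsmul_eq_mul,
        Nat.cast_pred Fintype.card_pos, mul_div_cancel₀ _ (sub_pos.mpr hcard).ne']
  rw [hset, ← prod_univ_sum letters fun i a ↦ mSC 𝔽 p (c i) a]
  simp only [hletter, prod_ite, prod_const, filter_mem_eq_inter, univ_inter, filter_not,
    ← compl_eq_univ_sdiff, bernoulliWeight]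

/-- A pattern corresponds to the set of positions where it is `1`: the correctly received positions
for an error pattern, the unerased ones for an erasure pattern. -/
def onesEquiv (n : ℕ) : (Fin n → Fin 2) ≃ Finset (Fin n) where
  toFun x := {i | x i = 1}
  invFun s i := if i ∈ s then 1 else 0
  left_inv x := by
    funext i
    simp only [mem_filter_univ]
    split_ifs <;> omega
  right_inv s := by
    ext i
    simp

lemma distortion_eq {n : ℕ} (x y : Fin n → Fin 2) :
    distortion x y = #(onesEquiv n x)ᶜ + #(onesEquiv n x ∆ onesEquiv n y) := by
  have hletter (a b : Fin 2) :
      δmBM1 a b = (if a ≠ 1 then 1 else 0) + if ¬ (a = 1 ↔ b = 1) then 1 else 0 := by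
    fin_cases a <;> fin_cases b <;> norm_num [δmBM1]
  have hcompl : (onesEquiv n x)ᶜ = ({i | x i ≠ 1} : Finset (Fin n)) := by
    ext i
    simp [onesEquiv]
  have hsymmDiff :
      onesEquiv n x ∆ onesEquiv n y = ({i | ¬ (x i = 1 ↔ y i = 1)} : Finset (Fin n)) := by
    ext i
    simp only [onesEquiv, mem_symmDiff, Equiv.coe_fn_mk, mem_filter_univ]
    tauto
  simp only [distortion, hletter, sum_add_distrib, sum_boole, hcompl, hsymmDiff]

lemma errorProb_eq_missProb {𝔽 : Type*} [Fintype 𝔽] [DecidableEq 𝔽] [Nontrivial 𝔽] {n : ℕ}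
    (p D : ℝ) (B : Finset (Fin n → Fin 2)) (c : Fin n → 𝔽) :
    errorProb p D B c = missProb p D (B.map (onesEquiv n).toEmbedding) := by
  classical
  have hones (r : Fin n → 𝔽) : onesEquiv n (errorPattern c r) = ({i | r i = c i} : Finset _) := by
    ext i
    simp [onesEquiv, errorPattern]
  have hmiss (r : Fin n → 𝔽) : (∀ y ∈ B, D < distortion (errorPattern c r) y) ↔
      ({i | r i = c i} : Finset _) ∈ uncovered D (B.map (onesEquiv n).toEmbedding) := by
    simp only [mem_uncovered, forall_mem_map, Equiv.coe_toEmbedding, distortion_eq, hones]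
  unfold errorProb missProb
  rw [← sum_filter, ← sum_fiberwise_of_maps_to (t := uncovered D _)
    fun r hr ↦ (hmiss r).mp (mem_filter.mp hr).2]
  refine sum_congr rfl fun s hs ↦ ?_
  rw [← sum_prod_mSC p c, filter_filter]
  refine sum_congr (filter_congr fun r _ ↦ ?_) fun _ _ ↦ rfl
  rw [hmiss, and_iff_right_iff_imp]
  rintro rfl
  exact hs

end Channel

section Achievability

lemma eventually_exists_cover {d v r : ℝ} (hd : d < 1) (hv : v ∈ hDomain d) (hr : hRate d v < r) :
    ∀ᶠ n : ℕ in atTop, ∃ T : Finset (Finset (Fin n)), (#T : ℝ) ≤ (2 : ℝ) ^ (n * r) ∧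
      ∀ s ∈ uncovered (n * d) T, (#s : ℝ) ≤ v * n := by
  obtain ⟨hv1, hv2⟩ := hv
  have hrate : Real.binEntropy v - Real.binEntropy (v + d - 1) < r * Real.log 2 := by
    rw [← hRate_mul_log_two]
    exact mul_lt_mul_of_pos_right hr (Real.log_pos one_lt_two)
  filter_upwards [eventually_exists_hammingCover (by linarith) (by linarith) (by linarith) hrate
    (tendsto_ceil_mul_div (by linarith))] with n ⟨T, hT, hcover⟩
  refine ⟨T, by rwa [two_rpow_eq_exp, mul_assoc], fun s hs ↦ ?_⟩
  by_contra! hlt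
  obtain ⟨s', hs's, hs'⟩ := exists_subset_card_eq (Nat.ceil_le.mpr hlt.le)
  obtain ⟨t, ht, hst⟩ := hcover s' hs'
  have hanti : (#sᶜ + #(s ∆ t) : ℝ) ≤ #s'ᶜ + #(s' ∆ t) :=
    mod_cast card_compl_add_card_symmDiff_anti hs's t
  have hs'_ge : v * n ≤ #s' := hs' ▸ Nat.le_ceil _
  have hs'_compl : (#s'ᶜ : ℝ) + #s' = n := mod_cast (card_compl_add_card s').trans (by simp)
  linarith [mem_uncovered.mp hs t ht]

lemma eventually_exists_missProb_le {d u p ε : ℝ} (hd : d < 1) (hu : u ∈ hDomain d) (hup : u ≤ p)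
    (hp : p < 1) (hε : 0 < ε) :
    ∀ᶠ n : ℕ in atTop, ∃ T : Finset (Finset (Fin n)), (#T : ℝ) ≤ (2 : ℝ) ^ (n * hRate d u) ∧
      missProb p (n * d) T ≤ (2 : ℝ) ^ (-(n * (klBits u p - ε))) := by
  have hu0 : 0 < u := by linarith [hu.1]
  have hp0 : 0 < p := hu0.trans_le hup
  rcases hup.eq_or_lt with rfl | hlt
  · refine .of_forall fun n ↦ ⟨∅, by rw [card_empty, Nat.cast_zero]; positivity, ?_⟩
    refine (missProb_le_one hp0.le hp.le _ _).trans (Real.one_le_rpow one_le_two ?_)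
    rw [klBits_self hp0.ne' hp.ne, zero_sub, mul_neg, neg_neg]
    positivity
  have hklBits : ∀ᶠ v : ℝ in 𝓝[>] u, klBits u p - ε < klBits v p :=
    ((continuous_klBits hp0.ne' hp.ne).continuousWithinAt.tendsto).eventually_const_lt
      (sub_lt_self _ hε)
  obtain ⟨v, hklv, huv, hv⟩ := (hklBits.and (Ioo_mem_nhdsGT (lt_min hlt hu.2))).exists
  obtain ⟨hvp, hvd⟩ := lt_min_iff.mp hv
  have hv_mem : v ∈ hDomain d := ⟨hu.1.trans huv.le, hvd⟩
  have hrate : hRate d v < hRate d u :=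
    hRate_strictAntiOn hd (Set.Ico_subset_Icc_self hu) (Set.Ico_subset_Icc_self hv_mem) huv
  filter_upwards [eventually_exists_cover hd hv_mem hrate] with n ⟨T, hT, hcover⟩
  refine ⟨T, hT, ?_⟩
  calc missProb p (n * d) T
      ≤ ∑ s : Finset (Fin n) with (#s : ℝ) ≤ v * Fintype.card (Fin n), bernoulliWeight p s :=
        sum_le_sum_of_subset_of_nonneg
          (fun s hs ↦ by simpa using hcover s hs)
          fun s _ _ ↦ bernoulliWeight_nonneg hp0.le hp.le s
    _ ≤ (2 : ℝ) ^ (-(n * klBits v p)) := by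
      simpa using sum_bernoulliWeight_card_le (α := Fin n) (hu0.trans huv) hvp.le hp
    _ ≤ (2 : ℝ) ^ (-(n * (klBits u p - ε))) := by
      gcongr
      exact one_le_two

lemma exists_forall_eventually_missProb_le {d u p : ℝ} (hd : d < 1) (hu : u ∈ hDomain d)
    (hup : u ≤ p) (hp : p < 1) :
    ∃ T : ∀ n : ℕ, Finset (Finset (Fin n)), (∀ n, (#(T n) : ℝ) ≤ (2 : ℝ) ^ (n * hRate d u)) ∧
      ∀ ε > 0, ∀ᶠ n : ℕ in atTop,
        missProb p (n * d) (T n) ≤ (2 : ℝ) ^ (-(n * (klBits u p - ε))) := by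
  -- Taking the best family at each length makes the choice independent of `ε`.
  have hmin (n : ℕ) := Set.exists_min_image
    {T : Finset (Finset (Fin n)) | (#T : ℝ) ≤ (2 : ℝ) ^ (n * hRate d u)} (missProb p (n * d))
    (Set.toFinite _) ⟨∅, by
      rw [Set.mem_ofPred_eq, card_empty, Nat.cast_zero]
      positivity⟩
  choose T hT hTmin using hmin
  refine ⟨T, hT, fun ε hε ↦ ?_⟩
  filter_upwards [eventually_exists_missProb_le hd hu hup hp hε] with n ⟨T', hT', hle⟩
  exact (hTmin n T' hT').trans hle

end Achievability

section Converse

lemma sdiff_uncovered_subset {α : Type*} [Fintype α] [DecidableEq α] {D σ : ℝ}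
    {S T : Finset (Finset α)} (hS : ∀ s ∈ S, D - #sᶜ ≤ σ * Fintype.card α) :
    S \ uncovered D T ⊆
      T.biUnion fun t ↦ {s : Finset α | (#(s ∆ t) : ℝ) ≤ σ * Fintype.card α} := by
  intro s hs
  rw [Finset.mem_sdiff, mem_uncovered] at hs
  push Not at hs
  obtain ⟨hsS, t, ht, hst⟩ := hs
  exact mem_biUnion.mpr ⟨t, ht, mem_filter_univ _ |>.mpr (by linarith [hS s hsS])⟩

lemma card_sdiff_uncovered_le {α : Type*} [Fintype α] [DecidableEq α] {D σ : ℝ} (h0 : 0 < σ)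
    (h1 : σ ≤ 1 / 2) {S : Finset (Finset α)} (hS : ∀ s ∈ S, D - #sᶜ ≤ σ * Fintype.card α)
    (T : Finset (Finset α)) :
    (#(S \ uncovered D T) : ℝ) ≤ #T * Real.exp (Fintype.card α * Real.binEntropy σ) :=
  calc (#(S \ uncovered D T) : ℝ)
      ≤ ∑ t ∈ T, (#{s : Finset α | (#(s ∆ t) : ℝ) ≤ σ * Fintype.card α} : ℝ) :=
        mod_cast (card_le_card (sdiff_uncovered_subset hS)).trans card_biUnion_le
    _ ≤ ∑ _ ∈ T, Real.exp (Fintype.card α * Real.binEntropy σ) :=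
      sum_le_sum fun t _ ↦ card_hammingBall_le h0 h1 t
    _ = #T * Real.exp (Fintype.card α * Real.binEntropy σ) := by rw [sum_const, nsmul_eq_mul]

lemma floor_mul_le_self {v : ℝ} (h0 : 0 ≤ v) (h1 : v ≤ 1) (n : ℕ) : ⌊v * n⌋₊ ≤ n := by
  have hle : (⌊v * n⌋₊ : ℝ) ≤ n :=
    (Nat.floor_le (by positivity)).trans (mul_le_of_le_one_left n.cast_nonneg h1)
  exact_mod_cast hle

lemma one_sub_mul_le_card_compl {v : ℝ} (h0 : 0 ≤ v) {n : ℕ} {s : Finset (Fin n)}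
    (hs : #s = ⌊v * n⌋₊) : (1 - v) * n ≤ #sᶜ := by
  have hfloor : (#s : ℝ) ≤ v * n := hs ▸ Nat.floor_le (by positivity)
  have hcompl : (#sᶜ : ℝ) + #s = n := mod_cast (card_compl_add_card s).trans (by simp)
  linarith

lemma eventually_powersetCard_subset_uncovered {d v : ℝ} (h0 : 0 ≤ v) (hv : v < 1 - d)
    (T : ∀ n : ℕ, Finset (Finset (Fin n))) :
    ∀ᶠ n : ℕ in atTop, powersetCard ⌊v * n⌋₊ univ ⊆ uncovered (n * d) (T n) := by
  filter_upwards [eventually_gt_atTop 0] with n hn s hs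
  have hn0 : (0 : ℝ) < n := mod_cast hn
  have hcompl := one_sub_mul_le_card_compl h0 (mem_powersetCard.mp hs).2
  refine mem_uncovered.mpr fun t _ ↦ ?_
  have : (0 : ℝ) ≤ #(s ∆ t) := Nat.cast_nonneg _
  nlinarith

lemma eventually_half_choose_le_of_lt_hRate {d v r : ℝ} (hd : d < 1) (hv1 : 1 - d < v)
    (hv2 : v < 1 - d / 2) (hr : r < hRate d v) {T : ∀ n : ℕ, Finset (Finset (Fin n))}
    (hT : ∀ n, (#(T n) : ℝ) ≤ (2 : ℝ) ^ (n * r)) :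
    ∀ᶠ n : ℕ in atTop, (n.choose ⌊v * n⌋₊ : ℝ) / 2 ≤
      #(powersetCard ⌊v * n⌋₊ univ ∩ uncovered (n * d) (T n)) := by
  have hv0 : 0 ≤ v := by linarith
  have hle := floor_mul_le_self hv0 (show v ≤ 1 by linarith)
  have hlog_choose := tendsto_log_choose_div (.of_forall hle) tendsto_natCast_div_self
    (by simpa using tendsto_floor_mul_div hv0)
  rw [one_mul] at hlog_choose
  have hchoose_pos (n : ℕ) : (0 : ℝ) < n.choose ⌊v * n⌋₊ := mod_cast Nat.choose_pos (hle n)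
  have hgap : r * Real.log 2 + Real.binEntropy (v + d - 1) < Real.binEntropy v := by
    linarith [hRate_mul_log_two d v, mul_lt_mul_of_pos_right hr (Real.log_pos one_lt_two)]
  obtain ⟨τ, hτ1, hτ2⟩ := exists_between hgap
  filter_upwards [eventually_add_one_mul_exp_le hτ1, eventually_gt_atTop 0,
    eventually_exp_mul_le (.of_forall hchoose_pos) hlog_choose hτ2] with n hexp hn hchoose
  set S : Finset (Finset (Fin n)) := powersetCard ⌊v * n⌋₊ univ
  have hball : ∀ s ∈ S, n * d - #sᶜ ≤ (v + d - 1) * Fintype.card (Fin n) := fun s hs ↦ by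
    rw [Fintype.card_fin]
    linarith [one_sub_mul_le_card_compl hv0 (mem_powersetCard.mp hs).2]
  have hcovered : 2 * (#(S \ uncovered (n * d) (T n)) : ℝ) ≤ n.choose ⌊v * n⌋₊ :=
    calc 2 * (#(S \ uncovered (n * d) (T n)) : ℝ)
        ≤ (n + 1) * ((2 : ℝ) ^ (n * r) * Real.exp (n * Real.binEntropy (v + d - 1))) := by
          gcongr
          · exact_mod_cast Nat.succ_le_succ hn
          · refine (card_sdiff_uncovered_le (by linarith) (by linarith) hball _).trans ?_
            rw [Fintype.card_fin]
            gcongr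
            exact hT n
      _ = (n + 1) * Real.exp (n * (r * Real.log 2 + Real.binEntropy (v + d - 1))) := by
        rw [two_rpow_eq_exp, ← Real.exp_add]
        ring_nf
      _ ≤ n.choose ⌊v * n⌋₊ := hexp.trans hchoose
  have hsplit : (#(S \ uncovered (n * d) (T n)) : ℝ) + #(S ∩ uncovered (n * d) (T n)) =
      n.choose ⌊v * n⌋₊ := by
    rw [← Nat.cast_add, card_sdiff_add_card_inter, card_powersetCard, card_univ, Fintype.card_fin]
  linarith

lemma eventually_half_choose_le {d u : ℝ} (hd : d < 1) (hu : u ∈ hDomain d)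
    {T : ∀ n : ℕ, Finset (Finset (Fin n))} (hT : ∀ n, (#(T n) : ℝ) ≤ (2 : ℝ) ^ (n * hRate d u)) :
    ∀ᶠ v : ℝ in 𝓝[<] u, ∀ᶠ n : ℕ in atTop, (n.choose ⌊v * n⌋₊ : ℝ) / 2 ≤
      #(powersetCard ⌊v * n⌋₊ univ ∩ uncovered (n * d) (T n)) := by
  rcases hu.1.eq_or_lt with rfl | hlt
  · filter_upwards [Ioo_mem_nhdsLT (sub_pos.mpr hd)] with v hv
    filter_upwards [eventually_powersetCard_subset_uncovered hv.1.le hv.2 T] with n hn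
    rw [inter_eq_left.mpr hn, card_powersetCard, card_univ, Fintype.card_fin]
    exact half_le_self (Nat.cast_nonneg _)
  · filter_upwards [Ioo_mem_nhdsLT hlt] with v hv
    have hvd : v < 1 - d / 2 := hv.2.trans hu.2
    exact eventually_half_choose_le_of_lt_hRate hd hv.1 hvd
      (hRate_strictAntiOn hd ⟨hv.1.le, hvd.le⟩ (Set.Ico_subset_Icc_self hu) hv.2) hT

lemma card_inter_mul_le_missProb {p : ℝ} (hp0 : 0 ≤ p) (hp1 : p ≤ 1) {n : ℕ} (D : ℝ) (k : ℕ)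
    (T : Finset (Finset (Fin n))) :
    #(powersetCard k univ ∩ uncovered D T) * (p ^ k * (1 - p) ^ (n - k)) ≤ missProb p D T := by
  have hweight : ∀ s ∈ powersetCard k univ ∩ uncovered D T,
      bernoulliWeight p s = p ^ k * (1 - p) ^ (n - k) := fun s hs ↦ by
    rw [bernoulliWeight, card_compl, Fintype.card_fin,
      (mem_powersetCard.mp (mem_of_mem_inter_left hs)).2]
  rw [← nsmul_eq_mul, ← sum_const, ← sum_congr rfl hweight]
  exact sum_le_sum_of_subset_of_nonneg inter_subset_right fun s _ _ ↦
    bernoulliWeight_nonneg hp0 hp1 s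

lemma eventually_le_missProb_of_half_choose_le {d v p ε : ℝ} (hv0 : 0 ≤ v) (hv1 : v ≤ 1)
    (hp0 : 0 < p) (hp1 : p < 1) (hε : 0 < ε) {T : ∀ n : ℕ, Finset (Finset (Fin n))}
    (hT : ∀ᶠ n : ℕ in atTop, (n.choose ⌊v * n⌋₊ : ℝ) / 2 ≤
      #(powersetCard ⌊v * n⌋₊ univ ∩ uncovered (n * d) (T n))) :
    ∀ᶠ n : ℕ in atTop, (2 : ℝ) ^ (-(n * (klBits v p + ε))) ≤ missProb p (n * d) (T n) := by
  have : 0 < 1 - p := sub_pos.mpr hp1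
  have hle := floor_mul_le_self hv0 hv1
  have hpos (n : ℕ) :
      0 < n.choose ⌊v * n⌋₊ * (p ^ ⌊v * n⌋₊ * (1 - p) ^ (n - ⌊v * n⌋₊)) := by
    have := Nat.choose_pos (hle n)
    positivity
  have hlt : -((klBits v p + ε) * Real.log 2) < -(klBits v p * Real.log 2) := by
    nlinarith [mul_pos hε (Real.log_pos one_lt_two)]
  obtain ⟨τ, hτ1, hτ2⟩ := exists_between hlt
  filter_upwards [hT, eventually_add_one_mul_exp_le hτ1, eventually_gt_atTop 0,
    eventually_exp_mul_le (.of_forall hpos)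
      (tendsto_log_binomial_div hp0 hp1 (.of_forall hle) (tendsto_floor_mul_div hv0)) hτ2]
    with n hhalf hexp hn hbinomial
  have hn1 : (1 : ℝ) ≤ n := mod_cast hn
  have htwo : 2 * (2 : ℝ) ^ (-(n * (klBits v p + ε))) ≤
      n.choose ⌊v * n⌋₊ * (p ^ ⌊v * n⌋₊ * (1 - p) ^ (n - ⌊v * n⌋₊)) := by
    rw [two_rpow_eq_exp, neg_mul, mul_assoc, ← mul_neg]
    refine le_trans ?_ (hexp.trans hbinomial)
    gcongr
    linarith
  calc (2 : ℝ) ^ (-(n * (klBits v p + ε)))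
      ≤ n.choose ⌊v * n⌋₊ / 2 * (p ^ ⌊v * n⌋₊ * (1 - p) ^ (n - ⌊v * n⌋₊)) := by linarith
    _ ≤ #(powersetCard ⌊v * n⌋₊ univ ∩ uncovered (n * d) (T n)) *
          (p ^ ⌊v * n⌋₊ * (1 - p) ^ (n - ⌊v * n⌋₊)) := by gcongr
    _ ≤ missProb p (n * d) (T n) := card_inter_mul_le_missProb hp0.le hp1.le _ _ _

lemma eventually_le_missProb {d u p ε : ℝ} (hd : d < 1) (hu : u ∈ hDomain d) (hp0 : 0 < p)
    (hp1 : p < 1) (hε : 0 < ε) {T : ∀ n : ℕ, Finset (Finset (Fin n))}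
    (hT : ∀ n, (#(T n) : ℝ) ≤ (2 : ℝ) ^ (n * hRate d u)) :
    ∀ᶠ n : ℕ in atTop, (2 : ℝ) ^ (-(n * (klBits u p + ε))) ≤ missProb p (n * d) (T n) := by
  have hu0 : 0 < u := by linarith [hu.1]
  have hklBits : ∀ᶠ v : ℝ in 𝓝[<] u, klBits v p < klBits u p + ε / 2 :=
    ((continuous_klBits hp0.ne' hp1.ne).continuousWithinAt.tendsto).eventually_lt_const
      (lt_add_of_pos_right _ (half_pos hε))
  obtain ⟨v, ⟨hklv, hhalf⟩, hv0, hvu⟩ :=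
    ((hklBits.and (eventually_half_choose_le hd hu hT)).and (Ioo_mem_nhdsLT hu0)).exists
  have hv1 : v ≤ 1 := by linarith [hu.1, hu.2]
  filter_upwards [eventually_le_missProb_of_half_choose_le hv0.le hv1 hp0 hp1 (half_pos hε) hhalf]
    with n hn
  refine (Real.rpow_le_rpow_of_exponent_le one_le_two (neg_le_neg ?_)).trans hn
  exact mul_le_mul_of_nonneg_left (by linarith) n.cast_nonneg

end Converse

section Exponents

variable {𝔽 : ℕ → Type*} [∀ n, Fintype (𝔽 n)] [∀ n, DecidableEq (𝔽 n)] {p : ℝ} {N : ℕ} {R D : ℝ}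

lemma ExponentAchievable.le_of_exponentConverse [∀ n, Nonempty (𝔽 n)] {F F' : ℝ} (hN : N ≠ 0)
    (hF' : ExponentAchievable 𝔽 p N R D F') (hF : ExponentConverse 𝔽 p N R D F) : F' ≤ F := by
  have hN0 : (0 : ℝ) < N := mod_cast hN.bot_lt
  obtain ⟨B, hB, hle⟩ := hF'
  by_contra! hlt
  have hε : 0 < (F' / N - F / N) / 3 := by
    rw [← sub_div]
    exact div_pos (div_pos (sub_pos.mpr hlt) hN0) three_pos
  obtain ⟨n, ⟨hupper, hlower⟩, hn⟩ :=
    (((hle _ hε).and (hF B hB _ hε)).and (eventually_gt_atTop 0)).exists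
  let c : Fin n → 𝔽 n := fun _ ↦ Classical.arbitrary _
  have hpow := (hlower c).trans (hupper c)
  rw [Real.rpow_le_rpow_left_iff one_lt_two, neg_le_neg_iff,
    mul_le_mul_iff_right₀ (by exact_mod_cast hn)] at hpow
  linarith

variable [∀ n, Nontrivial (𝔽 n)]

lemma exponentConverse_klBits {u : ℝ} (hN : N ≠ 0) (hd : D / N < 1) (hu : u ∈ hDomain (D / N))
    (hr : hRate (D / N) u = R / N) (hp0 : 0 < p) (hp1 : p < 1) :
    ExponentConverse 𝔽 p N R D (N * klBits u p) := by
  intro B hB ε hε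
  filter_upwards [eventually_le_missProb hd hu hp0 hp1 hε
    (T := fun n ↦ (B n).map (onesEquiv n).toEmbedding) fun n ↦ by
      rw [card_map, hr]
      exact hB n] with n hn c
  rwa [errorProb_eq_missProb, mul_div_cancel_left₀ _ (Nat.cast_ne_zero.mpr hN)]

lemma exponentAchievable_klBits {u : ℝ} (hN : N ≠ 0) (hd : D / N < 1) (hu : u ∈ hDomain (D / N))
    (hr : hRate (D / N) u = R / N) (hup : u ≤ p) (hp1 : p < 1) :
    ExponentAchievable 𝔽 p N R D (N * klBits u p) := by
  obtain ⟨T, hT, hle⟩ := exists_forall_eventually_missProb_le hd hu hup hp1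
  refine ⟨fun n ↦ (T n).map (onesEquiv n).symm.toEmbedding, fun n ↦ ?_, fun ε hε ↦ ?_⟩
  · rw [card_map, ← hr]
    exact hT n
  · filter_upwards [hle ε hε] with n hn c
    rw [errorProb_eq_missProb, Finset.map_map, ← Equiv.trans_toEmbedding, Equiv.symm_trans_self,
      Equiv.refl_toEmbedding, map_refl, mul_div_cancel_left₀ _ (Nat.cast_ne_zero.mpr hN)]
    exact hn

end Exponents

end

theorem theorem1_general (𝔽 : ℕ → Type*) [∀ n, Fintype (𝔽 n)] [∀ n, Nontrivial (𝔽 n)]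
    [∀ n, DecidableEq (𝔽 n)] (p : ℝ) (hp0 : 0 < p) (hp1 : p < 1) (N : ℕ) (R D : ℝ)
    (hD : D ∈ Set.Ioo (0 : ℝ) N) (hR : R ∈ Set.Ioc (0 : ℝ) (N * H₂ (1 - D / N))) :
    Set.BijOn (hRate (D / N)) (hDomain (D / N)) (Set.Ioc 0 (H₂ (1 - D / N))) ∧
    ExponentConverse 𝔽 p N R D (N * klBits (hInv (D / N) (R / N)) p) ∧
    (hInv (D / N) (R / N) ≤ p →
      IsGreatest {F : ℝ | ExponentAchievable 𝔽 p N R D F}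
        (N * klBits (hInv (D / N) (R / N)) p)) := by
  have hN : (0 : ℝ) < N := hD.1.trans hD.2
  have hN0 : N ≠ 0 := Nat.cast_ne_zero.mp hN.ne'
  have hd0 : 0 < D / N := div_pos hD.1 hN
  have hd1 : D / N < 1 := (div_lt_one hN).mpr hD.2
  have hr : R / N ∈ Set.Ioc 0 (H₂ (1 - D / N)) :=
    ⟨div_pos hR.1 hN, (div_le_iff₀' hN).mpr hR.2⟩
  have hu := hInv_mem hd0 hd1 hr
  have hru := hRate_hInv hd0 hd1 hr
  have hconverse := exponentConverse_klBits (𝔽 := 𝔽) hN0 hd1 hu hru hp0 hp1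
  exact ⟨hRate_bijOn hd0 hd1, hconverse, fun hup ↦
    ⟨exponentAchievable_klBits hN0 hd1 hu hru hup hp1,
      fun _ hF ↦ hF.le_of_exponentConverse hN0 hconverse⟩⟩

lemma pos_of_one_sub_div_card_sub_one_lt {𝔽 : Type*} [Fintype 𝔽] [Nontrivial 𝔽] {p : ℝ}
    (hp1 : p < 1) (hp : (1 - p) / ((Fintype.card 𝔽 : ℝ) - 1) < p) : 0 < p := by
  have hcard : (1 : ℝ) < Fintype.card 𝔽 := mod_cast Fintype.one_lt_card
  exact (div_pos (sub_pos.mpr hp1) (sub_pos.mpr hcard)).trans hp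

theorem theorem1 (𝔽 : ℕ → Type*) [∀ n, Field (𝔽 n)] [∀ n, Fintype (𝔽 n)]
    [∀ n, DecidableEq (𝔽 n)] (p : ℝ) (hp1 : p < 1)
    (hp : ∀ n, (1 - p) / ((Fintype.card (𝔽 n) : ℝ) - 1) < p)
    (N : ℕ) (R D : ℝ) (hD : D ∈ Set.Ioo (0 : ℝ) N)
    (hR : R ∈ Set.Ioc (0 : ℝ) (N * H₂ (1 - D / N))) :
    Set.BijOn (hRate (D / N)) (hDomain (D / N)) (Set.Ioc 0 (H₂ (1 - D / N))) ∧
    (hInv (D / N) (R / N) ≤ p →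
      IsGreatest {F : ℝ | ExponentAchievable 𝔽 p N R D F}
        (N * klBits (hInv (D / N) (R / N)) p) ∧
      ExponentConverse 𝔽 p N R D (N * klBits (hInv (D / N) (R / N)) p)) :=
  have ⟨hbij, hconverse, hgreatest⟩ := theorem1_general 𝔽 p
    (pos_of_one_sub_div_card_sub_one_lt hp1 (hp 0)) hp1 N R D hD hR
  ⟨hbij, fun hup ↦ ⟨hgreatest hup, hconverse⟩⟩
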